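/- Let $K$ be a field of characteristic $0$, let $N\ge 2$ and $m\ge n\ge 0$ be integers, and let $\kappa\in K$ with $\kappa\notin\{-1,-2,-3,\dots\}$. Write $(a)_j=\prod_{i=1}^{j}(a+i-1)$, and define polynomials $p_{kl}\in K[x_1,\dots,x_N]$ $(k,l\ge 0)$ by the generating function (formal power series in $s,t$, powers expanded by the binomial series) \[ \sum_{k,l\ge 0}p_{kl}(x)\,s^k t^l=(1-sx_1)^{-1}(1-tx_2)^{-1}\prod_{i=1}^{N}\bigl((1-sx_i)(1-tx_i)\bigr)^{-\kappa}. \] Put \[ \omega_{mn}=p_{mn}+\sum_{j=1}^{n}\frac{(-\kappa)_j\,(m-n+1)_{j-1}}{(\kappa+m-n+1)_j\,j!}\bigl((m-n+j)\,p_{m+j,n-j}+j\,p_{n-j,m+j}\bigr). \] If $2\kappa\ne -j$ for all $j=m-n+1,m-n+2,\dots,m$, then the polynomial $\omega_{mn}$ is not zero. -/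

import Mathlib

namespace Dunkl

noncomputable section

variable {K : Type*} [Field K] [CharZero K] {N : ℕ}

/-- The formal power series `(1 - x s) ^ a` in one variable `s`, with coefficients in
`K[x₁, …, x_N]`, for an exponent `a` in `K`: the binomial series `(1 + s) ^ a` at `-x s`. -/
def oneSubPow (x : MvPolynomial (Fin N) K) (a : K) : PowerSeries (MvPolynomial (Fin N) K) :=
  PowerSeries.rescale (-x) (PowerSeries.binomialSeries (MvPolynomial (Fin N) K) a)

/-- A power series in the inner variable `s`, viewed in `K[x₁, …, x_N][[s]][[t]]`. -/
def inS : PowerSeries (MvPolynomial (Fin N) K) →+*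
    PowerSeries (PowerSeries (MvPolynomial (Fin N) K)) :=
  PowerSeries.C

/-- A power series in one variable, viewed as a series in the outer variable `t` in
`K[x₁, …, x_N][[s]][[t]]`. -/
def inT : PowerSeries (MvPolynomial (Fin N) K) →+*
    PowerSeries (PowerSeries (MvPolynomial (Fin N) K)) :=
  PowerSeries.map PowerSeries.C

/-- The generating function
`(1 - s x₁)⁻¹ (1 - t x₂)⁻¹ ∏ᵢ ((1 - s xᵢ) (1 - t xᵢ)) ^ (-κ)` in `K[x₁, …, x_N][[s]][[t]]`.
The variables `x₁, x₂` have the indices `0, 1` of `Fin N`. -/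
def genFun (hN : 2 ≤ N) (κ : K) : PowerSeries (PowerSeries (MvPolynomial (Fin N) K)) :=
  inS (oneSubPow (MvPolynomial.X ⟨0, by omega⟩) (-1)) *
    inT (oneSubPow (MvPolynomial.X ⟨1, by omega⟩) (-1)) *
    ∏ i : Fin N, (inS (oneSubPow (MvPolynomial.X i) (-κ)) *
      inT (oneSubPow (MvPolynomial.X i) (-κ)))

/-- The polynomial `p_{mn}`, the coefficient of `s ^ m t ^ n` in the generating function. -/
def p (hN : 2 ≤ N) (κ : K) (m n : ℕ) : MvPolynomial (Fin N) K :=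
  PowerSeries.coeff m (PowerSeries.coeff n (genFun hN κ))

/-- The Pochhammer symbol `(a)_n = a (a + 1) ⋯ (a + n - 1)`. -/
def poch (a : K) (n : ℕ) : K := (ascPochhammer K n).eval a

/-- The polynomial `ω_{mn}` for `m ≥ n`. -/
def omega (hN : 2 ≤ N) (κ : K) (m n : ℕ) : MvPolynomial (Fin N) K :=
  p hN κ m n + ∑ j ∈ Finset.Icc 1 n,
    (poch (-κ) j * poch ((m - n : ℕ) + 1 : K) (j - 1) /
        (poch (κ + (m - n : ℕ) + 1) j * (j.factorial : K))) •
      (((m - n : ℕ) + j : K) • p hN κ (m + j) (n - j) + (j : K) • p hN κ (n - j) (m + j))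

end

end Dunkl

/-! Restrict `ω_{mn}` to `(x, y, 0, …, 0)`. The generating function separates in `s` and `t`, so
each `p_{kl}` becomes a product of two one-variable coefficients, both expressible through the
symmetric kernel `((1 - xs)(1 - ys))^(-κ-1)`. Its three-term recurrence makes the sum over `j`
telescope, giving `n(κ+m) ω_{mn} = (2κ+m)(κ+n) xy ω_{m-1,n-1}` (`omegaVal_succ_right`). At `(1, -1)`
the kernel is `(1 - s²)^(-κ-1)`, so the case `n = 0` is nonzero. The factors `2κ+m` met in climbing
back along fixed `m - n` are those the hypothesis keeps nonzero. -/

namespace Dunkl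

open PowerSeries

/-! ### Binomial series and the kernel recurrence -/

section Series

variable {K : Type*} [Field K]

/-- The coefficients of a power series, extended by zero to negative indices. -/
noncomputable def zcoeff (f : K⟦X⟧) (k : ℤ) : K := if 0 ≤ k then coeff k.toNat f else 0

theorem zcoeff_natCast (f : K⟦X⟧) (k : ℕ) : zcoeff f k = coeff k f := by
  simp [zcoeff]

theorem zcoeff_of_neg (f : K⟦X⟧) {k : ℤ} (hk : k < 0) : zcoeff f k = 0 := by
  simp [zcoeff, not_le.mpr hk]

theorem zcoeff_add (f g : K⟦X⟧) (k : ℤ) : zcoeff (f + g) k = zcoeff f k + zcoeff g k := by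
  unfold zcoeff; split_ifs <;> simp

theorem zcoeff_sub (f g : K⟦X⟧) (k : ℤ) : zcoeff (f - g) k = zcoeff f k - zcoeff g k := by
  unfold zcoeff; split_ifs <;> simp

theorem zcoeff_C_mul (a : K) (f : K⟦X⟧) (k : ℤ) : zcoeff (C a * f) k = a * zcoeff f k := by
  unfold zcoeff; split_ifs <;> simp

theorem zcoeff_X_mul (f : K⟦X⟧) (k : ℤ) : zcoeff (X * f) k = zcoeff f (k - 1) := by
  rcases lt_or_ge k 0 with hk | hk
  · rw [zcoeff_of_neg _ hk, zcoeff_of_neg _ (by omega)]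
  · lift k to ℕ using hk
    cases k with
    | zero => rw [zcoeff_natCast, zcoeff_of_neg _ (by simp)]; simp
    | succ k =>
      rw [zcoeff_natCast, coeff_succ_X_mul, Nat.cast_succ, add_sub_cancel_right, zcoeff_natCast]

theorem zcoeff_X_mul_derivative (f : K⟦X⟧) (k : ℤ) :
    zcoeff (X * d⁄dX K f) k = k * zcoeff f k := by
  rw [zcoeff_X_mul]
  rcases lt_or_ge k 0 with hk | hk
  · rw [zcoeff_of_neg _ hk, zcoeff_of_neg _ (by omega), mul_zero]
  · lift k to ℕ using hk
    cases k with
    | zero => rw [zcoeff_of_neg _ (by simp)]; simp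
    | succ k =>
      rw [zcoeff_natCast, Nat.cast_succ, add_sub_cancel_right, zcoeff_natCast, coeff_derivative]
      push_cast
      ring

variable [CharZero K]

/-- The binomial series `(1 - x s) ^ a` with scalar `x`. -/
noncomputable def binSeries (x a : K) : K⟦X⟧ := rescale (-x) (binomialSeries K a)

theorem binSeries_add (x a b : K) : binSeries x (a + b) = binSeries x a * binSeries x b := by
  simp [binSeries]

theorem binSeries_one (x : K) : binSeries x 1 = 1 - C x * X := by
  have h : binomialSeries K (1 : K) = 1 + X := by
    simpa using binomialSeries_nat (R := K) (A := K) 1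
  rw [binSeries, h, map_add, map_one, rescale_X, map_neg]
  ring

theorem binSeries_zero_left (a : K) : binSeries 0 a = 1 := by
  simp [binSeries]

theorem constantCoeff_binSeries (x a : K) : constantCoeff (binSeries x a) = 1 := by
  rw [← coeff_zero_eq_constantCoeff_apply, binSeries, coeff_rescale]
  simp

theorem choose_succ_mul (a : K) (k : ℕ) :
    Ring.choose a (k + 1) * (k + 1) = Ring.choose a k * (a - k) := by
  have h := Ring.choose_smul_choose a (Nat.le_succ k)
  simpa [Nat.succ_eq_add_one, mul_comm] using h

theorem one_sub_mul_derivative_binSeries (x a : K) :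
    (1 - C x * X) * d⁄dX K (binSeries x a) = -C (a * x) * binSeries x a := by
  ext k
  rw [sub_mul, one_mul, mul_assoc, map_sub, coeff_C_mul, neg_mul, map_neg, coeff_C_mul,
    coeff_derivative]
  have h (k : ℕ) : coeff k (binSeries x a) = (-x) ^ k * Ring.choose a k := by
    simp [binSeries]
  cases k with
  | zero =>
    simp only [coeff_zero_X_mul, h]
    simp
    ring
  | succ k =>
    have := choose_succ_mul a (k + 1)
    rw [coeff_succ_X_mul, coeff_derivative, h, h]
    push_cast at this ⊢
    linear_combination (-x) ^ (k + 2) * this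

/-- The series `((1 - x s) (1 - y s)) ^ (-κ - 1)`. -/
noncomputable def kerSeries (κ x y : K) : K⟦X⟧ :=
  binSeries x (-κ - 1) * binSeries y (-κ - 1)

theorem kerSeries_comm (κ x y : K) : kerSeries κ x y = kerSeries κ y x :=
  mul_comm _ _

/-- Coefficients of `(1 - xs)(1 - ys) f' = (κ+1)(x + y - 2xys) f`, multiplied by `s` so that `s f'`
acts as multiplication by the index. Zero extension removes boundary cases. -/
theorem zcoeff_kerSeries_rec (κ x y : K) (k : ℤ) :
    k * zcoeff (kerSeries κ x y) k =
      (κ + k) * (x + y) * zcoeff (kerSeries κ x y) (k - 1) -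
        (2 * κ + k) * (x * y) * zcoeff (kerSeries κ x y) (k - 2) := by
  set f := kerSeries κ x y with hf
  have hD : d⁄dX K f - C (x + y) * (X * d⁄dX K f) + C (x * y) * (X * (X * d⁄dX K f)) =
      C ((κ + 1) * (x + y)) * f - C (2 * (κ + 1) * (x * y)) * (X * f) := by
    have hx := one_sub_mul_derivative_binSeries x (-κ - 1)
    have hy := one_sub_mul_derivative_binSeries y (-κ - 1)
    rw [hf, kerSeries, Derivation.leibniz, smul_eq_mul, smul_eq_mul]
    simp only [map_mul, map_add, map_sub, map_neg, map_one, map_ofNat] at hx hy ⊢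
    linear_combination (1 - C x * X) * binSeries x (-κ - 1) * hy +
      (1 - C y * X) * binSeries y (-κ - 1) * hx
  obtain ⟨D, hDf⟩ : ∃ D, X * d⁄dX K f = D := ⟨_, rfl⟩
  have hX : D + C (x * y) * (X * (X * D)) + C (2 * (κ + 1) * (x * y)) * (X * (X * f)) =
      C ((κ + 1) * (x + y)) * (X * f) + C (x + y) * (X * D) := by
    rw [← hDf]
    linear_combination X * hD
  have hz (i : ℤ) : zcoeff D i = i * zcoeff f i := hDf ▸ zcoeff_X_mul_derivative f i
  have h := congrArg (fun g => zcoeff g k) hX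
  simp only [zcoeff_add, zcoeff_C_mul, zcoeff_X_mul, hz] at h
  rw [sub_sub, show (1 : ℤ) + 1 = 2 from rfl] at h
  push_cast at h
  linear_combination h

/-- The coefficients of `(1 - x s) ^ (-κ - 1) * (1 - y s) ^ (-κ)`. -/
noncomputable def pairCoeff (κ x y : K) (k : ℤ) : K :=
  zcoeff (kerSeries κ x y) k - y * zcoeff (kerSeries κ x y) (k - 1)

theorem coeff_binSeries_mul (κ x y : K) (k : ℕ) :
    coeff k (binSeries x (-1) * (binSeries x (-κ) * binSeries y (-κ))) = pairCoeff κ x y k := by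
  have hx : binSeries x (-κ - 1) = binSeries x (-1) * binSeries x (-κ) := by
    rw [← binSeries_add]; congr 1; ring
  have hy : binSeries y (-κ) = binSeries y (-κ - 1) * (1 - C y * X) := by
    rw [← binSeries_one, ← binSeries_add]; congr 1; ring
  have h : binSeries x (-1) * (binSeries x (-κ) * binSeries y (-κ)) =
      kerSeries κ x y - C y * (X * kerSeries κ x y) := by
    rw [kerSeries, hx, hy]; ring
  rw [h, ← zcoeff_natCast, zcoeff_sub, zcoeff_C_mul, zcoeff_X_mul, pairCoeff]

theorem pairCoeff_of_neg (κ x y : K) {k : ℤ} (hk : k < 0) : pairCoeff κ x y k = 0 := by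
  rw [pairCoeff, zcoeff_of_neg _ hk, zcoeff_of_neg _ (by omega)]; simp

/-- At `x = 1`, `y = -1` the kernel series is `(1 - s ^ 2) ^ (-κ - 1)`. -/
theorem zcoeff_kerSeries_one_neg_one {κ : K} (hκ : ∀ k : ℕ, 1 ≤ k → κ ≠ -(k : K)) (i : ℕ) :
    zcoeff (kerSeries κ 1 (-1)) (2 * i) ≠ 0 ∧ zcoeff (kerSeries κ 1 (-1)) (2 * i - 1) = 0 := by
  induction i with
  | zero =>
    refine ⟨?_, zcoeff_of_neg _ (by simp)⟩
    have := zcoeff_natCast (kerSeries κ 1 (-1)) 0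
    simp only [Nat.cast_zero, mul_zero] at this ⊢
    rw [this, coeff_zero_eq_constantCoeff_apply, kerSeries, map_mul, constantCoeff_binSeries,
      constantCoeff_binSeries]
    simp
  | succ i ih =>
    -- Since `x + y = 0`, the recurrence links only indices two apart.
    have h₀ := zcoeff_kerSeries_rec κ 1 (-1) (2 * (i + 1 : ℕ))
    have h₁ := zcoeff_kerSeries_rec κ 1 (-1) (2 * (i + 1 : ℕ) - 1)
    rw [show (2 * (i + 1 : ℕ) - 2 : ℤ) = 2 * i by push_cast; ring] at h₀
    rw [show (2 * (i + 1 : ℕ) - 1 - 2 : ℤ) = 2 * i - 1 by push_cast; ring, ih.2] at h₁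
    constructor
    · intro h
      rw [h] at h₀
      have : (2 * (κ + (i + 1 : ℕ))) * zcoeff (kerSeries κ 1 (-1)) (2 * i) = 0 := by
        push_cast at h₀ ⊢
        linear_combination -h₀
      rcases mul_eq_zero.mp this with h' | h'
      · refine hκ (i + 1) (by omega) ?_
        have := (mul_eq_zero.mp h').resolve_left two_ne_zero
        linear_combination this
      · exact ih.1 h'
    · have hne : (((2 * (i + 1 : ℕ) - 1 : ℤ)) : K) ≠ 0 := by
        rw [Int.cast_ne_zero]; omega
      refine (mul_eq_zero.mp (h₁.trans ?_)).resolve_left hne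
      ring

theorem pairCoeff_one_neg_one_ne_zero {κ : K} (hκ : ∀ k : ℕ, 1 ≤ k → κ ≠ -(k : K)) (d : ℕ) :
    pairCoeff κ 1 (-1) d ≠ 0 := by
  rcases Nat.even_or_odd' d with ⟨i, rfl | rfl⟩
  · have h := zcoeff_kerSeries_one_neg_one hκ i
    simpa [pairCoeff, h.2] using h.1
  · have h := (zcoeff_kerSeries_one_neg_one hκ i).1
    have h' := (zcoeff_kerSeries_one_neg_one hκ (i + 1)).2
    rw [show (2 * (i + 1 : ℕ) - 1 : ℤ) = 2 * i + 1 by push_cast; ring] at h'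
    simpa [pairCoeff, h'] using h

end Series

/-! ### Telescoping and the contiguity relation -/

section Contiguity

variable {K : Type*} [Field K]

theorem poch_zero (a : K) : poch a 0 = 1 := by simp [poch]

theorem poch_succ (a : K) (j : ℕ) : poch a (j + 1) = poch a j * (a + j) := by
  simp [poch, ascPochhammer_succ_eval]

theorem poch_ne_zero {a : K} {j : ℕ} (h : ∀ i : ℕ, a + i ≠ 0) : poch a j ≠ 0 := by
  induction j with
  | zero => simp [poch_zero]
  | succ j ih => rw [poch_succ]; exact mul_ne_zero ih (h j)

variable [CharZero K]

/-- The coefficient of the `j`-th summand in `omega`, where `d` stands for `m - n`. -/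
noncomputable def wt (κ : K) (d j : ℕ) : K :=
  poch (-κ) j * poch (d + 1 : K) (j - 1) / (poch (κ + d + 1) j * (j.factorial : K))

/-- The value of `omega` at `(x, y, 0, …, 0)`, with integer parameters `m`, `n` and
the sum running over `1 ≤ j ≤ J`. -/
noncomputable def omegaVal (κ x y : K) (d J : ℕ) (m n : ℤ) : K :=
  pairCoeff κ x y m * pairCoeff κ y x n + ∑ j ∈ Finset.Icc 1 J,
    wt κ d j * ((d + j) * (pairCoeff κ x y (m + j) * pairCoeff κ y x (n - j)) +
      j * (pairCoeff κ x y (n - j) * pairCoeff κ y x (m + j)))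

/-- The antidifference in the contiguity relation for `omegaVal`. -/
noncomputable def telescoper (κ x y : K) (m n a b : ℤ) : K :=
  let g := zcoeff (kerSeries κ x y);
  -((κ + m) * x + (κ + n) * y) * g a * g b + (m + n + 2 * κ) * (x * y) *
    (g (a - 1) * g b + g a * g (b - 1)) -
      (x * y) * ((κ + n) * x + (κ + m) * y) * g (a - 1) * g (b - 1)

/-- A polynomial identity modulo the kernel recurrences at `m + j` and `n - j`. The factors on the
two telescopers match the ratio of consecutive weights in `wt_succ`. -/
theorem telescoper_step (κ x y : K) (d j m n : ℤ) (hd : m = n + d) :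
    (d + j) * (n * (κ + m) * (pairCoeff κ x y (m + j) * pairCoeff κ y x (n - j)) -
        (2 * κ + m) * (κ + n) * (x * y) *
          (pairCoeff κ x y (m - 1 + j) * pairCoeff κ y x (n - 1 - j))) +
      j * (n * (κ + m) * (pairCoeff κ x y (n - j) * pairCoeff κ y x (m + j)) -
        (2 * κ + m) * (κ + n) * (x * y) *
          (pairCoeff κ x y (n - 1 - j) * pairCoeff κ y x (m - 1 + j))) +
      j * (κ + d + j) * telescoper κ x y m n (m + j - 1) (n - j) =
    (d + j) * (j - κ) * telescoper κ x y m n (m + j) (n - j - 1) := by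
  have ha := zcoeff_kerSeries_rec κ x y (m + j)
  have hb := zcoeff_kerSeries_rec κ x y (n - j)
  simp only [pairCoeff, telescoper, kerSeries_comm κ y x]
  rw [show m - 1 + j = m + j - 1 by ring, show n - 1 - j = n - j - 1 by ring]
  simp only [sub_sub _ (1 : ℤ) 1, show (1 : ℤ) + 1 = 2 from rfl]
  generalize zcoeff (kerSeries κ x y) (m + j) = a₀ at *
  generalize zcoeff (kerSeries κ x y) (m + j - 1) = a₁ at *
  generalize zcoeff (kerSeries κ x y) (m + j - 2) = a₂ at *
  generalize zcoeff (kerSeries κ x y) (n - j) = b₀ at *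
  generalize zcoeff (kerSeries κ x y) (n - j - 1) = b₁ at *
  generalize zcoeff (kerSeries κ x y) (n - j - 2) = b₂ at *
  subst hd
  push_cast at *
  grind

/-- This is `telescoper_step` at `j = 0` with the factor `d` cancelled; it needs its own proof
because `d` may vanish. -/
theorem telescoper_init (κ x y : K) (m n : ℤ) :
    n * (κ + m) * (pairCoeff κ x y m * pairCoeff κ y x n) -
        (2 * κ + m) * (κ + n) * (x * y) *
          (pairCoeff κ x y (m - 1) * pairCoeff κ y x (n - 1)) =
      -κ * telescoper κ x y m n m (n - 1) := by
  have ha := zcoeff_kerSeries_rec κ x y m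
  have hb := zcoeff_kerSeries_rec κ x y n
  simp only [pairCoeff, telescoper, kerSeries_comm κ y x]
  simp only [sub_sub _ (1 : ℤ) 1, show (1 : ℤ) + 1 = 2 from rfl]
  generalize zcoeff (kerSeries κ x y) m = a₀ at *
  generalize zcoeff (kerSeries κ x y) (m - 1) = a₁ at *
  generalize zcoeff (kerSeries κ x y) (m - 2) = a₂ at *
  generalize zcoeff (kerSeries κ x y) n = b₀ at *
  generalize zcoeff (kerSeries κ x y) (n - 1) = b₁ at *
  generalize zcoeff (kerSeries κ x y) (n - 2) = b₂ at *
  grind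

theorem wt_one {κ : K} {d : ℕ} (hκ : ∀ k : ℕ, 1 ≤ k → κ ≠ -(k : K)) :
    wt κ d 1 * (κ + d + 1) = -κ := by
  have h : κ + d + 1 ≠ 0 := fun h => hκ (d + 1) (by omega) (by push_cast; linear_combination h)
  simp only [wt, poch, ascPochhammer_one, ascPochhammer_zero, Polynomial.eval_X,
    Polynomial.eval_one, Nat.sub_self, Nat.factorial_one]
  field_simp
  simp

theorem wt_succ {κ : K} {d j : ℕ} (hκ : ∀ k : ℕ, 1 ≤ k → κ ≠ -(k : K)) (hj : 1 ≤ j) :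
    wt κ d (j + 1) * ((j + 1) * (κ + d + (j + 1))) = wt κ d j * ((d + j) * (j - κ)) := by
  obtain ⟨j, rfl⟩ : ∃ i, j = i + 1 := ⟨j - 1, by omega⟩
  have hne (i : ℕ) : κ + d + 1 + i ≠ 0 := fun h =>
    hκ (d + 1 + i) (by omega) (by push_cast; linear_combination h)
  have h₀ : poch (κ + d + 1) (j + 1) ≠ 0 := poch_ne_zero hne
  have h₁ := hne (j + 1)
  have h₂ : ((j + 1).factorial : K) ≠ 0 := by exact_mod_cast Nat.factorial_ne_zero _
  have h₃ : ((j + 1 + 1 : ℕ) : K) ≠ 0 := Nat.cast_ne_zero.mpr (j + 1).succ_ne_zero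
  simp only [wt, Nat.add_sub_cancel, poch_succ _ (j + 1), Nat.factorial_succ (j + 1),
    poch_succ (d + 1 : K) j, Nat.cast_mul]
  rw [div_mul_eq_mul_div, div_mul_eq_mul_div,
    div_eq_div_iff (mul_ne_zero (mul_ne_zero h₀ h₁) (mul_ne_zero h₃ h₂)) (mul_ne_zero h₀ h₂)]
  push_cast
  ring

theorem telescoped_sum {κ : K} (hκ : ∀ k : ℕ, 1 ≤ k → κ ≠ -(k : K)) (x y : K) (d J : ℕ)
    (m n : ℤ) (hd : m = n + d) :
    n * (κ + m) * omegaVal κ x y d (J + 1) m n -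
        (2 * κ + m) * (κ + n) * (x * y) * omegaVal κ x y d (J + 1) (m - 1) (n - 1) =
      wt κ d (J + 1) * ((d + (J + 1)) * (J + 1 - κ)) *
        telescoper κ x y m n (m + (J + 1)) (n - (J + 1) - 1) := by
  induction J with
  | zero =>
    have h₀ := telescoper_init κ x y m n
    have h₁ := telescoper_step κ x y d 1 m n hd
    have hw := wt_one (d := d) hκ
    simp only [omegaVal, zero_add, Finset.Icc_self, Finset.sum_singleton]
    push_cast at h₁ ⊢
    rw [zero_add, add_sub_cancel_right] at *
    linear_combination h₀ + wt κ d 1 * h₁ - telescoper κ x y m n m (n - 1) * hw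
  | succ J ih =>
    have h₁ := telescoper_step κ x y d (J + 1 + 1) m n hd
    have hw := wt_succ (d := d) (j := J + 1) hκ (by omega)
    simp only [omegaVal, Finset.sum_Icc_succ_top (show 1 ≤ J + 1 + 1 by omega)] at ih ⊢
    rw [show m + ((J : ℤ) + 1 + 1) - 1 = m + (J + 1) by ring,
      show n - ((J : ℤ) + 1 + 1) = n - (J + 1) - 1 by ring] at h₁
    push_cast at h₁ hw ih ⊢
    rw [show n - ((J : ℤ) + 1 + 1) = n - (J + 1) - 1 by ring]
    linear_combination ih + wt κ d (J + 1 + 1) * h₁ -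
      telescoper κ x y m n (m + (J + 1)) (n - (J + 1) - 1) * hw

theorem omegaVal_succ_right {κ : K} (hκ : ∀ k : ℕ, 1 ≤ k → κ ≠ -(k : K)) (x y : K) (d n : ℕ) :
    ((n : K) + 1) * (κ + (n + 1 + d)) * omegaVal κ x y d (n + 1) (n + 1 + d) (n + 1) =
      (2 * κ + (n + 1 + d)) * (κ + (n + 1)) * (x * y) * omegaVal κ x y d n (n + d) n := by
  have h := telescoped_sum hκ x y d n (n + 1 + d) (n + 1) rfl
  -- The last argument is `-1`, and every term of the telescoper has a kernel coefficient at `-1` or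
  -- `-2`.
  have ht : telescoper κ x y (n + 1 + d) (n + 1) (n + 1 + d + (n + 1))
      (n + 1 - (n + 1) - 1) = 0 := by
    simp [telescoper, zcoeff_of_neg]
  -- The extra summand `j = n + 1` carries the index `-1`, so it vanishes.
  have hl : omegaVal κ x y d (n + 1) (n + 1 + d - 1) (n + 1 - 1) =
      omegaVal κ x y d n (n + d) n := by
    rw [show (n : ℤ) + 1 + d - 1 = n + d by ring, add_sub_cancel_right, omegaVal, omegaVal,
      Finset.sum_Icc_succ_top (by omega), pairCoeff_of_neg κ y x (k := n - (n + 1 : ℕ)) (by simp),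
      pairCoeff_of_neg κ x y (k := n - (n + 1 : ℕ)) (by simp)]
    simp
  rw [ht, hl, mul_zero, sub_eq_zero] at h
  exact_mod_cast h

theorem omegaVal_one_neg_one_ne_zero {κ : K} (hκ : ∀ k : ℕ, 1 ≤ k → κ ≠ -(k : K)) (d n : ℕ)
    (h : ∀ j ∈ Finset.Icc (d + 1) (n + d), 2 * κ ≠ -(j : K)) :
    omegaVal κ 1 (-1) d n (n + d) n ≠ 0 := by
  induction n with
  | zero =>
    have h₀ := pairCoeff_one_neg_one_ne_zero hκ d
    have h₁ : pairCoeff κ (-1) 1 0 ≠ 0 := by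
      have := (zcoeff_kerSeries_one_neg_one hκ 0).1
      simpa [pairCoeff, zcoeff_of_neg, kerSeries_comm κ (-1) 1] using this
    simpa [omegaVal] using ⟨h₀, h₁⟩
  | succ n ih =>
    have ih := ih fun j hj => h j (by rw [Finset.mem_Icc] at hj ⊢; omega)
    intro h₀
    have hs := omegaVal_succ_right hκ 1 (-1) d n
    push_cast at h₀
    rw [h₀, mul_zero, eq_comm] at hs
    refine mul_ne_zero (mul_ne_zero (mul_ne_zero ?_ ?_) (by simp)) ih hs
    · intro h'
      refine h (n + 1 + d) (by rw [Finset.mem_Icc]; omega) ?_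
      push_cast
      linear_combination h'
    · intro h'
      refine hκ (n + 1) (by omega) ?_
      push_cast
      linear_combination h'

end Contiguity

/-! ### Evaluation at `(x, y, 0, …, 0)` -/

section Specialization

variable {K : Type*} [Field K] [CharZero K] {N : ℕ}

theorem p_eq_coeff_mul_coeff (hN : 2 ≤ N) (κ : K) (k l : ℕ) :
    p hN κ k l =
      coeff k (oneSubPow (MvPolynomial.X (⟨0, by omega⟩ : Fin N)) (-1) *
          ∏ i : Fin N, oneSubPow (MvPolynomial.X i) (-κ)) *
        coeff l (oneSubPow (MvPolynomial.X (⟨1, by omega⟩ : Fin N)) (-1) *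
          ∏ i : Fin N, oneSubPow (MvPolynomial.X i) (-κ)) := by
  set F := ∏ i : Fin N, oneSubPow (MvPolynomial.X i) (-κ) with hF
  have h : genFun hN κ = C (oneSubPow (MvPolynomial.X (⟨0, by omega⟩ : Fin N)) (-1) * F) *
      PowerSeries.map C (oneSubPow (MvPolynomial.X (⟨1, by omega⟩ : Fin N)) (-1) * F) := by
    rw [genFun, Finset.prod_mul_distrib, ← map_prod, ← map_prod, ← hF, map_mul, map_mul]
    simp only [inS, inT]
    ring
  rw [p, h, coeff_C_mul, coeff_map, coeff_mul_C]

theorem map_oneSubPow (φ : MvPolynomial (Fin N) K →ₐ[K] K) (q : MvPolynomial (Fin N) K) (a : K) :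
    PowerSeries.map (φ : MvPolynomial (Fin N) K →+* K) (oneSubPow q a) = binSeries (φ q) a := by
  ext k
  simp [oneSubPow, binSeries, mul_comm]

/-- Evaluation at the point `(x, y, 0, …, 0)`. -/
noncomputable def evalPair (N : ℕ) (x y : K) : MvPolynomial (Fin N) K →ₐ[K] K :=
  MvPolynomial.aeval fun i : Fin N => if (i : ℕ) = 0 then x else if (i : ℕ) = 1 then y else 0

theorem map_evalPair_prod (hN : 2 ≤ N) (κ x y : K) :
    PowerSeries.map (evalPair N x y : MvPolynomial (Fin N) K →+* K)
        (∏ i : Fin N, oneSubPow (MvPolynomial.X i) (-κ)) =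
      binSeries x (-κ) * binSeries y (-κ) := by
  obtain ⟨M, rfl⟩ : ∃ M, N = M + 1 + 1 := ⟨N - 2, by omega⟩
  rw [map_prod, Fin.prod_univ_succ, Fin.prod_univ_succ]
  simp only [map_oneSubPow]
  simp [evalPair, binSeries_zero_left]

theorem evalPair_p (hN : 2 ≤ N) (κ x y : K) (k l : ℕ) :
    evalPair N x y (p hN κ k l) = pairCoeff κ x y k * pairCoeff κ y x l := by
  rw [p_eq_coeff_mul_coeff, map_mul]
  have hc (k : ℕ) (f : PowerSeries (MvPolynomial (Fin N) K)) : evalPair N x y (coeff k f) =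
      coeff k (PowerSeries.map (evalPair N x y : MvPolynomial (Fin N) K →+* K) f) := by
    simp
  rw [hc, hc, map_mul (PowerSeries.map _), map_mul (PowerSeries.map _), map_evalPair_prod hN,
    map_oneSubPow, map_oneSubPow, ← coeff_binSeries_mul, ← coeff_binSeries_mul,
    mul_comm (binSeries y (-κ))]
  simp [evalPair]

theorem evalPair_omega (hN : 2 ≤ N) (κ x y : K) (m n : ℕ) :
    evalPair N x y (omega hN κ m n) = omegaVal κ x y (m - n) n m n := by
  rw [omega, omegaVal, map_add, map_sum, evalPair_p]
  congr 1
  refine Finset.sum_congr rfl fun j hj => ?_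
  have hj : ((n - j : ℕ) : ℤ) = n - j := Nat.cast_sub (Finset.mem_Icc.mp hj).2
  simp only [map_smul, map_add, evalPair_p, smul_eq_mul, wt, Nat.cast_add, hj]

end Specialization

end Dunkl

theorem mainTheorem3 {K : Type*} [Field K] [CharZero K] (N : ℕ) (hN : 2 ≤ N) (κ : K)
    (hκ : ∀ k : ℕ, 1 ≤ k → κ ≠ -(k : K)) (m n : ℕ) (hmn : n ≤ m)
    (h : ∀ j ∈ Finset.Icc (m - n + 1) m, 2 * κ ≠ -(j : K)) :
    Dunkl.omega hN κ m n ≠ 0 := by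
  obtain ⟨d, rfl⟩ := Nat.exists_eq_add_of_le hmn
  rw [Nat.add_sub_cancel_left] at h
  intro h₀
  refine Dunkl.omegaVal_one_neg_one_ne_zero hκ d n h ?_
  have := Dunkl.evalPair_omega hN κ 1 (-1) (n + d) n
  rw [h₀, map_zero, Nat.add_sub_cancel_left] at this
  exact_mod_cast this.symm
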